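/- Let $T$ be the set of functions $f:\omega\to\omega$ with finite range. A condition $p$ consists of an unbounded sequence $g_p:\omega\to\omega$ and a number $\mathrm{stem}(p)$ such that $g_p$ is non-decreasing from $\mathrm{stem}(p)$ on and $g_p(i)\le g_p(\mathrm{stem}(p))$ for all $i<\mathrm{stem}(p)$. Give $T$ the topology generated by the sets $\{f\in T : f(n)=g_p(n)\text{ for } n<\mathrm{stem}(p),\ f(n)\le g_p(n)\text{ for } n\ge \mathrm{stem}(p)\}$, for all conditions $p$. Let $M$ be the full topological model over $T$. Its elements (names) are, inductively, the sets $\sigma=\{\langle\sigma_j,r_j\rangle : j\in J\}$ with $\sigma_j$ a name and $r_j$ an open subset of $T$. Truth values are open subsets of $T$: $[\![x\in y]\!]=\bigcup_{\langle z,r\rangle\in y} r\cap[\![x=z]\!]$; $[\![x=y]\!]$ is the truth value of "every element of $x$ is an element of $y$ and vice versa"; connectives and quantifiers over $M$ are interpreted in the complete Heyting algebra of open sets. $T\Vdash\varphi$ means $[\![\varphi]\!]=T$. Ground-model sets have the canonical names $\hat x=\{\langle\hat y,T\rangle : y\in x\}$, and the natural numbers of $M$ are $\hat\omega$. The generic term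 is $\mathcal G=\{\langle\hat r,r\rangle : r\subseteq T\text{ open}\}$. Let $G$ be the name $\{\langle \widehat{(n,x)},\{f\in T: f(n)=x\}\rangle : n,x\in\omega\}$ and $\mathrm{rng}(G)$ the name $\{\langle\hat x,\{f\in T: f(n)=x\}\rangle : n,x\in\omega\}$. In $M$, a set $A$ of natural numbers is *countable* if it is the range of a function with domain the natural numbers; it is *pseudo-bounded* if every sequence $(a_n)$ of members of $A$ satisfies $\lim_n a_n/n=0$, i.e. for every $k\in\mathbb N$ there is $N\in\mathbb N$ with $k\,a_n<n$ for all $n\ge N$; it is *bounded* if some $B\in\mathbb N$ satisfies $x\le B$ for all $x\in A$. BD-$\mathbb N$ is the statement that every countable pseudo-bounded set of natural numbers is bounded. **Theorem.** 1. $T\Vdash$ $G$ is the function determined by the generic term (that is, for all $z$: $z\in G$ if and only if there is $r\in\mathcal G$ with $z\in f$ for all $f\in r$), $G$ is a function from $\mathbb N$ to $\mathbb N$, and $\mathrm{rng}(G)$ is its range. 2. $T\Vdash$ $\mathrm{rng}(G)$ is a set of natural numbers which is countable and pseudo-bounded, and it is not bounded. 3. Consequently $T\Vdash\neg\,$BD-$\mathbb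 N$. 4. $T\Vdash$ Dependent Choice: for every formula $\varphi(x,y)$ of the language of set theory with parameters from $M$, $T$ forces both (a) if $\forall x\,\exists y\,\varphi(x,y)$, then for every $x_0$ there is a function $a$ on $\mathbb N$ with $a_0=x_0$ and $\varphi(a_n,a_{n+1})$ for all $n$; and (b) for every set $A$, if $\forall x\in A\,\exists y\in A\ \varphi(x,y)$, then for every $x_0\in A$ there is a function $a:\mathbb N\to A$ with $a_0=x_0$ and $\varphi(a_n,a_{n+1})$ for all $n$. -/

import Mathlib

universe u v

namespace TopModel

open TopologicalSpace

/-! ### Heyting-valued names over a complete Heyting algebra -/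

/-- A name (term): a family of pairs `⟨σ_j, r_j⟩` with `σ_j` a name and `r_j` a truth value,
indexed by a ground-model set `J`. For `H = Opens T` these are the elements of the full
topological model over `T`; the ground model `V` is the universe of sets coded in `Type u`. -/
inductive Name (H : Type v) : Type (max (u + 1) v)
  | mk (J : Type u) (elt : J → Name H) (val : J → H) : Name H

/-- The canonical name `x̂ = {⟨ŷ, ⊤⟩ | y ∈ x}` of a ground-model set `x`. -/
def check {H : Type v} [Order.Frame H] : PSet.{u} → Name.{u, v} H
  | PSet.mk J A => Name.mk J (fun j => check (A j)) (fun _ => ⊤)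

section Semantics

variable {H : Type v} [Order.Frame H]

/-- The truth value of `x = y`: every element of `x` is equal to some element of `y`,
and vice versa. -/
def eqV : Name.{u, v} H → Name.{u, v} H → H
  | Name.mk I A a, Name.mk J B b =>
      (⨅ i : I, a i ⇨ ⨆ j : J, b j ⊓ eqV (A i) (B j)) ⊓
      (⨅ j : J, b j ⇨ ⨆ i : I, a i ⊓ eqV (A i) (B j))

/-- The truth value of `x ∈ y`. -/
def memV (x : Name.{u, v} H) : Name.{u, v} H → H
  | Name.mk J B b => ⨆ j : J, b j ⊓ eqV x (B j)

/-- Formulas of the language of set theory with free variables indexed by `Fin n`. A quantifier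
binds the new variable `0` and shifts the others up by one. -/
inductive SetFormula : ℕ → Type
  | mem {n : ℕ} (i j : Fin n) : SetFormula n
  | eq {n : ℕ} (i j : Fin n) : SetFormula n
  | bot {n : ℕ} : SetFormula n
  | and {n : ℕ} (φ ψ : SetFormula n) : SetFormula n
  | or {n : ℕ} (φ ψ : SetFormula n) : SetFormula n
  | imp {n : ℕ} (φ ψ : SetFormula n) : SetFormula n
  | all {n : ℕ} (φ : SetFormula (n + 1)) : SetFormula n
  | ex {n : ℕ} (φ : SetFormula (n + 1)) : SetFormula n

/-- The truth value of a formula under an assignment of names to its free variables. -/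
def SetFormula.value : {n : ℕ} → SetFormula n → (Fin n → Name.{u, v} H) → H
  | _, .mem i j, w => memV (w i) (w j)
  | _, .eq i j, w => eqV (w i) (w j)
  | _, .bot, _ => ⊥
  | _, .and φ ψ, w => φ.value w ⊓ ψ.value w
  | _, .or φ ψ, w => φ.value w ⊔ ψ.value w
  | _, .imp φ ψ, w => φ.value w ⇨ ψ.value w
  | _, .all φ, w => ⨅ x : Name.{u, v} H, φ.value (Matrix.vecCons x w)
  | _, .ex φ, w => ⨆ x : Name.{u, v} H, φ.value (Matrix.vecCons x w)

/-! The following are the truth values of the usual set-theoretic formulas: conjunction is `⊓`,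
disjunction is `⊔`, implication is `⇨`, negation is `ᶜ`, and the quantifiers over the model
are `⨅` and `⨆` over all names. -/

/-- Truth value of a biconditional. -/
def iffV (a b : H) : H := (a ⇨ b) ⊓ (b ⇨ a)

/-- `∀ x ∈ A, φ x`. -/
def allIn (A : Name.{u, v} H) (φ : Name.{u, v} H → H) : H :=
  ⨅ x : Name.{u, v} H, memV x A ⇨ φ x

/-- `∃ x ∈ A, φ x`. -/
def exIn (A : Name.{u, v} H) (φ : Name.{u, v} H → H) : H :=
  ⨆ x : Name.{u, v} H, memV x A ⊓ φ x

/-- `A ⊆ B`. -/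
def subsetV (A B : Name.{u, v} H) : H := allIn A fun x => memV x B

/-- `z = {x, y}`. -/
def isUPair (z x y : Name.{u, v} H) : H :=
  ⨅ w : Name.{u, v} H, iffV (memV w z) (eqV w x ⊔ eqV w y)

/-- `z = (x, y) = {{x}, {x, y}}`. -/
def isPair (z x y : Name.{u, v} H) : H :=
  ⨅ w : Name.{u, v} H, iffV (memV w z) (isUPair w x x ⊔ isUPair w x y)

/-- `(x, y) ∈ F`, that is, `F(x) = y` when `F` is a function. -/
def appV (F x y : Name.{u, v} H) : H :=
  ⨆ z : Name.{u, v} H, isPair z x y ⊓ memV z F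

/-- `F` is a function with domain `A`. -/
def isFunOn (F A : Name.{u, v} H) : H :=
  (allIn F fun z => exIn A fun x => ⨆ y : Name.{u, v} H, isPair z x y) ⊓
  (allIn A fun x => ⨆ y : Name.{u, v} H, appV F x y) ⊓
  (⨅ (x : Name.{u, v} H) (y : Name.{u, v} H) (y' : Name.{u, v} H),
    appV F x y ⊓ appV F x y' ⇨ eqV y y')

/-- `F` is a function from `A` to `B`. -/
def isFun (F A B : Name.{u, v} H) : H :=
  isFunOn F A ⊓
  (⨅ (x : Name.{u, v} H) (y : Name.{u, v} H), appV F x y ⇨ memV y B)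

/-- `R` is the range of `F`, where `F` is a function with domain `A`. -/
def isRange (R F A : Name.{u, v} H) : H :=
  ⨅ y : Name.{u, v} H, iffV (memV y R) (exIn A fun x => appV F x y)

/-- `n' = n ∪ {n}`. -/
def isSucc (n' n : Name.{u, v} H) : H :=
  ⨅ w : Name.{u, v} H, iffV (memV w n') (memV w n ⊔ eqV w n)

/-- The natural numbers of the model: the canonical name of the ground-model `ω`. -/
def omegaN : Name.{u, v} H := check PSet.omega

/-- The ordered pair `(x, y) = {{x}, {x, y}}` in the ground model. -/
def psPair (x y : PSet.{u}) : PSet.{u} := {{x}, {x, y}}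

/-- The graph `{((k, l), k * l) | k, l ∈ ω}` of multiplication in the ground model. -/
def mulGraph : PSet.{u} :=
  PSet.mk (ULift.{u} (ℕ × ℕ)) fun i =>
    psPair (psPair (PSet.ofNat i.down.1) (PSet.ofNat i.down.2))
      (PSet.ofNat (i.down.1 * i.down.2))

/-- `k * l < n`, for natural numbers `k`, `l`, `n` of the model. -/
def mulLt (k l n : Name.{u, v} H) : H :=
  ⨆ (q : Name.{u, v} H) (m : Name.{u, v} H),
    isPair q k l ⊓ appV (check mulGraph) q m ⊓ memV m n

/-- `x ≤ y`, for natural numbers (von Neumann ordinals) of the model. -/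
def leV (x y : Name.{u, v} H) : H := memV x y ⊔ eqV x y

/-- `A` is countable: it is the range of a function with domain the natural numbers. -/
def countableV (A : Name.{u, v} H) : H :=
  ⨆ h : Name.{u, v} H, isFunOn h omegaN ⊓ isRange A h omegaN

/-- The sequence `a` of natural numbers satisfies `lim a_n / n = 0`: for every `k` there is `N`
such that `k * a_n < n` for all `n ≥ N`. -/
def seqPseudoBounded (a : Name.{u, v} H) : H :=
  allIn omegaN fun k => exIn omegaN fun N => allIn omegaN fun n =>
    leV N n ⇨ ⨆ l : Name.{u, v} H, appV a n l ⊓ mulLt k l n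

/-- The set `A` of natural numbers is pseudo-bounded: every sequence of its members is. -/
def pseudoBounded (A : Name.{u, v} H) : H :=
  ⨅ a : Name.{u, v} H, isFun a omegaN A ⇨ seqPseudoBounded a

/-- The set `A` of natural numbers is bounded. -/
def boundedV (A : Name.{u, v} H) : H :=
  exIn omegaN fun B => allIn A fun x => leV x B

/-- The principle BD-ℕ: every countable pseudo-bounded set of natural numbers is bounded. -/
def bdN : H :=
  ⨅ A : Name.{u, v} H, subsetV A omegaN ⊓ countableV A ⊓ pseudoBounded A ⇨ boundedV A

/-- `a` is a function on the natural numbers with `a_0 = x₀` and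
`φ(a_n, a_{n+1})` for all `n`. -/
def isChain (φ : Name.{u, v} H → Name.{u, v} H → H) (x₀ a : Name.{u, v} H) : H :=
  isFunOn a omegaN ⊓ appV a (check ∅) x₀ ⊓
  (allIn omegaN fun n => ⨅ n' : Name.{u, v} H, isSucc n' n ⇨
    ⨆ (x : Name.{u, v} H) (y : Name.{u, v} H), appV a n x ⊓ appV a n' y ⊓ φ x y)

/-- Dependent choice over the whole model: if `∀ x ∃ y φ(x, y)`, then for every `x₀` there is a
sequence `a` with `a_0 = x₀` and `φ(a_n, a_{n+1})` for all `n`. -/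
def dcClass (φ : Name.{u, v} H → Name.{u, v} H → H) : H :=
  (⨅ x : Name.{u, v} H, ⨆ y : Name.{u, v} H, φ x y) ⇨
    ⨅ x₀ : Name.{u, v} H, ⨆ a : Name.{u, v} H, isChain φ x₀ a

/-- Dependent choice on sets: for every set `A`, if `∀ x ∈ A ∃ y ∈ A φ(x, y)`, then for every
`x₀ ∈ A` there is a sequence `a` of elements of `A` with `a_0 = x₀` and `φ(a_n, a_{n+1})` for
all `n`. -/
def dcSet (φ : Name.{u, v} H → Name.{u, v} H → H) : H :=
  ⨅ A : Name.{u, v} H,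
    (allIn A fun x => exIn A fun y => φ x y) ⇨
      allIn A fun x₀ => ⨆ a : Name.{u, v} H, isFun a omegaN A ⊓ isChain φ x₀ a

/-- The binary relation given by a formula `φ(x, y, w₀, …, w_{n-1})` with parameters `w`. -/
def relOf {n : ℕ} (φ : SetFormula (n + 2)) (w : Fin n → Name.{u, v} H)
    (x y : Name.{u, v} H) : H :=
  φ.value (Matrix.vecCons x (Matrix.vecCons y w))

end Semantics

/-! ### The space of functions with finite range -/

/-- The points of the space: functions from `ω` to `ω` with finite range. -/
def T : Type := {f : ℕ → ℕ // (Set.range f).Finite}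

/-- The data of a (nonempty) basic open set. -/
structure Cond where
  /-- the bounding sequence -/
  g : ℕ → ℕ
  /-- the length of the part that is fixed -/
  stem : ℕ
  unbounded : ∀ B : ℕ, ∃ n : ℕ, B < g n
  mono : ∀ m n : ℕ, stem ≤ m → m ≤ n → g m ≤ g n
  le_stem : ∀ i : ℕ, i < stem → g i ≤ g stem

/-- The basic open set given by a condition. -/
def Cond.toSet (p : Cond) : Set T :=
  {f : T | (∀ n : ℕ, n < p.stem → f.1 n = p.g n) ∧ (∀ n : ℕ, p.stem ≤ n → f.1 n ≤ p.g n)}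

instance : TopologicalSpace T := generateFrom (Set.range Cond.toSet)

theorem isOpen_value (n x : ℕ) : IsOpen {f : T | f.1 n = x} := by
  rw [isOpen_iff_forall_mem_open]
  intro f hf
  obtain ⟨B, hB⟩ := f.2.bddAbove
  have hB' : ∀ m, f.1 m ≤ B := fun m => hB ⟨m, rfl⟩
  let p : Cond :=
    { g := fun m => if m < n + 1 then f.1 m else B + m
      stem := n + 1
      unbounded := fun C => ⟨n + 1 + C, by
        rw [if_neg (by omega)]; omega⟩
      mono := fun a b ha hab => by
        rw [if_neg (by omega), if_neg (by omega)]; omega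
      le_stem := fun i hi => by
        have := hB' i
        rw [if_pos hi, if_neg (by omega)]; omega }
  refine ⟨p.toSet, ?_, isOpen_generateFrom_of_mem ⟨p, rfl⟩, ?_, ?_⟩
  · intro h hh
    have h1 : h.1 n = p.g n := hh.1 n (Nat.lt_succ_self n)
    have h2 : p.g n = f.1 n := if_pos (Nat.lt_succ_self n)
    exact (h1.trans h2).trans hf
  · intro m hm
    exact (if_pos hm).symm
  · intro m hm
    have h2 : p.g m = B + m := if_neg (not_lt.mpr hm)
    rw [h2]
    exact (hB' m).trans (Nat.le_add_right _ _)

/-- The open set of all `f` with `f n = x`. -/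
def valueOpen (n x : ℕ) : Opens T := ⟨{f : T | f.1 n = x}, isOpen_value n x⟩

/-- The full topological model over the space `T`. -/
abbrev Model : Type (u + 1) := Name.{u, 0} (Opens T)

/-- `T ⊩ φ`: the truth value of `φ` is the whole space. -/
def Forced (φ : Opens T) : Prop := φ = ⊤

/-- The point `f` of the space as a ground-model set: the graph `{(n, f n) | n ∈ ω}`. -/
def pointSet (f : T) : PSet.{u} :=
  PSet.mk (ULift.{u} ℕ) fun n => psPair (PSet.ofNat n.down) (PSet.ofNat (f.1 n.down))

/-- The open set `r` as a ground-model set, the set of its points. -/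
def openSet (r : Opens T) : PSet.{u} :=
  PSet.mk (ULift.{u} {f : T // f ∈ r}) fun f => pointSet f.down.1

/-- The generic term `{⟨r̂, r⟩ | r open}`. -/
def genericFilter : Model.{u} :=
  Name.mk (ULift.{u} (Opens T)) (fun r => check (openSet r.down)) (fun r => r.down)

/-- The generic `G` as a function: `(n, x)` belongs to it with truth value `{f | f n = x}`. -/
def genericFun : Model.{u} :=
  Name.mk (ULift.{u} (ℕ × ℕ))
    (fun i => check (psPair (PSet.ofNat i.down.1) (PSet.ofNat i.down.2)))
    (fun i => valueOpen i.down.1 i.down.2)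

/-- The range of the generic `G`. -/
def rngG : Model.{u} :=
  Name.mk (ULift.{u} (ℕ × ℕ))
    (fun i => check (PSet.ofNat i.down.2))
    (fun i => valueOpen i.down.1 i.down.2)

/-- `F` is the set of those `z` which belong to all points of some member of the generic term,
i.e. `F` is the function which the generic term determines. -/
def isGenericFun (F : Model.{u}) : Opens T :=
  ⨅ z : Model.{u}, iffV (memV z F)
    (exIn genericFilter fun r => allIn r fun f => memV z f)

end TopModel

/-!
*Dependent choice.* `T` has a basis of clopen sets and is hereditarily Lindelöf, being the union
of the compact metrizable subspaces of functions bounded by a constant. Hence every supremum of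
open sets is refined by a countable partition into open pieces, and gluing names along such a
partition shows that every existential statement has the same truth value as one of its instances.
With this maximum principle, the sequences required by dependent choice are obtained by iterating
a ground-model choice of witnesses.

*The generic range.* It is unbounded because the functions exceeding a given `B` are dense. For
pseudo-boundedness, let a name `a` be forced near `f` to be a sequence in `rng(G)`. At `f₁` the
members of `rng(G)` are the values of `f₁`, so if `f₁ ≤ ⌊n / (k + 1)⌋`, then `k * a (n + 1) < n + 1`
holds at `f₁`. The functions with this bound form a compact set, hence the inequality still holds
on the set of all functions below some `h n` which tends to infinity and is at least
`⌊n / (k + 1)⌋`. The pointwise infimum of the `h n` over all `n ≥ N` again tends to infinity, and it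
bounds `f` once `N` is large; the functions below it form a neighbourhood of `f` on which the
inequality holds for all `n ≥ N` at once.
-/

namespace TopModel

open TopologicalSpace Set Filter Topology

section Semantics

variable {H : Type v} [Order.Frame H]

theorem le_of_le_himp {a b c : H} (h : c ≤ a ⇨ b) (ha : c ≤ a) : c ≤ b :=
  (le_inf h ha).trans himp_inf_le

@[simp]
theorem iffV_self (a : H) : iffV a a = ⊤ := by
  simp only [iffV, himp_self, inf_idem]

/-! ### Equality and extensionality -/

/-- The index set `J` of the name `{⟨σ_j, r_j⟩ : j ∈ J}`. -/
def Name.idx : Name.{u, v} H → Type u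
  | .mk J _ _ => J

/-- The names `σ_j` occurring in the name `{⟨σ_j, r_j⟩ : j ∈ J}`. -/
def Name.elt : (x : Name.{u, v} H) → x.idx → Name.{u, v} H
  | .mk _ A _ => A

/-- The truth values `r_j` occurring in the name `{⟨σ_j, r_j⟩ : j ∈ J}`. -/
def Name.val : (x : Name.{u, v} H) → x.idx → H
  | .mk _ _ a => a

theorem memV_eq_iSup (x y : Name.{u, v} H) : memV x y = ⨆ j, y.val j ⊓ eqV x (y.elt j) := by
  cases y; rfl

theorem eqV_comm (x y : Name.{u, v} H) : eqV x y = eqV y x := by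
  induction x generalizing y with
  | mk I A a ih =>
    cases y
    simp only [eqV, ih, inf_comm]

theorem eqV_eq_iInf_memV (x y : Name.{u, v} H) : eqV x y =
    (⨅ i, x.val i ⇨ memV (x.elt i) y) ⊓ (⨅ j, y.val j ⇨ memV (y.elt j) x) := by
  cases x with | mk I A a
  cases y with | mk J B b
  have hswap : (⨅ j, b j ⇨ ⨆ i, a i ⊓ eqV (A i) (B j)) =
      ⨅ j, b j ⇨ ⨆ i, a i ⊓ eqV (B j) (A i) := by
    simp only [eqV_comm (B _)]
  rw [eqV, hswap]
  rfl

@[simp]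
theorem eqV_self (x : Name.{u, v} H) : eqV x x = ⊤ := by
  induction x with
  | mk I A a ih =>
    have hle (i : I) : a i ≤ ⨆ j, a j ⊓ eqV (A i) (A j) :=
      le_iSup_of_le i (by rw [ih, inf_top_eq])
    have hle' (i : I) : a i ≤ ⨆ j, a j ⊓ eqV (A j) (A i) :=
      le_iSup_of_le i (by rw [ih, inf_top_eq])
    simp only [eqV, himp_eq_top_iff.2 (hle _), himp_eq_top_iff.2 (hle' _), iInf_top, inf_idem]

theorem eqV_inf_val_le (x y : Name.{u, v} H) (i : x.idx) :
    eqV x y ⊓ x.val i ≤ memV (x.elt i) y := by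
  rw [eqV_eq_iInf_memV]
  exact le_himp_iff.1 (inf_le_of_left_le (iInf_le _ i))

theorem eqV_inf_eqV_le (x y z : Name.{u, v} H) : eqV x y ⊓ eqV y z ≤ eqV x z := by
  induction y generalizing x z with
  | mk J B b ih =>
    set y := Name.mk J B b
    have hsub (x z : Name.{u, v} H) (i : x.idx) :
        eqV x y ⊓ eqV y z ⊓ x.val i ≤ memV (x.elt i) z :=
      calc eqV x y ⊓ eqV y z ⊓ x.val i
          ≤ eqV y z ⊓ memV (x.elt i) y := by
            rw [inf_right_comm, inf_comm]
            exact inf_le_inf_left _ (eqV_inf_val_le x y i)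
        _ = ⨆ j, eqV y z ⊓ b j ⊓ eqV (x.elt i) (B j) := by
            simp only [memV_eq_iSup, inf_iSup_eq, inf_assoc]; rfl
        _ ≤ ⨆ j, memV (B j) z ⊓ eqV (x.elt i) (B j) :=
            iSup_mono fun j => inf_le_inf_right _ (eqV_inf_val_le y z j)
        _ ≤ memV (x.elt i) z := by
            simp only [memV_eq_iSup, iSup_inf_eq]
            refine iSup_le fun j => iSup_mono fun k => ?_
            rw [inf_assoc, inf_comm (eqV (B j) _)]
            exact inf_le_inf_left _ (ih j _ _)
    rw [eqV_eq_iInf_memV x z]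
    refine le_inf (le_iInf fun i => le_himp_iff.2 (hsub x z i))
      (le_iInf fun k => le_himp_iff.2 ?_)
    rw [inf_comm (eqV x y), eqV_comm y z, eqV_comm x y]
    exact hsub z x k

/-- A predicate on names is extensional if it respects the equality of the model. This is what is
needed to replace a quantifier over the members of a name by one over its index set. -/
@[fun_prop]
def ExtPred (φ : Name.{u, v} H → H) : Prop := ∀ x y, eqV x y ⊓ φ x ≤ φ y

/-- An operation on names is extensional if it respects the equality of the model; substituting it
into an extensional predicate gives an extensional predicate. -/
@[fun_prop]
def ExtFun (f : Name.{u, v} H → Name.{u, v} H) : Prop := ∀ x y, eqV x y ≤ eqV (f x) (f y)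

@[fun_prop]
theorem ExtFun.id : ExtFun (H := H) fun x : Name.{u, v} H => x := fun _ _ => le_rfl

@[fun_prop]
theorem ExtFun.const (a : Name.{u, v} H) : ExtFun fun _ : Name.{u, v} H => a := fun _ _ =>
  le_top.trans (eqV_self a).ge

namespace ExtPred

variable {φ ψ : Name.{u, v} H → H}

theorem le_of_le_eqV (hφ : ExtPred φ) {c : H} {x y : Name.{u, v} H} (hxy : c ≤ eqV x y)
    (hx : c ≤ φ x) : c ≤ φ y := (le_inf hxy hx).trans (hφ x y)

theorem eq_of_eqV_eq_top (hφ : ExtPred φ) {x y : Name.{u, v} H} (h : eqV x y = ⊤) :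
    φ x = φ y :=
  le_antisymm (hφ.le_of_le_eqV (le_top.trans h.ge) le_rfl)
    (hφ.le_of_le_eqV (le_top.trans ((eqV_comm y x).trans h).ge) le_rfl)

@[fun_prop]
protected theorem const (a : H) : ExtPred fun _ : Name.{u, v} H => a := fun _ _ => inf_le_right

@[fun_prop]
protected theorem inf (hφ : ExtPred φ) (hψ : ExtPred ψ) : ExtPred fun x => φ x ⊓ ψ x :=
  fun _ _ => le_inf (hφ.le_of_le_eqV inf_le_left (inf_le_of_right_le inf_le_left))
    (hψ.le_of_le_eqV inf_le_left (inf_le_of_right_le inf_le_right))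

@[fun_prop]
protected theorem sup (hφ : ExtPred φ) (hψ : ExtPred ψ) : ExtPred fun x => φ x ⊔ ψ x :=
  fun x y => by
    rw [inf_sup_left]
    exact sup_le_sup (hφ x y) (hψ x y)

@[fun_prop]
protected theorem himp (hφ : ExtPred φ) (hψ : ExtPred ψ) : ExtPred fun x => φ x ⇨ ψ x :=
  fun x y => by
    have hφx : eqV x y ⊓ (φ x ⇨ ψ x) ⊓ φ y ≤ φ x :=
      hφ.le_of_le_eqV (inf_le_of_left_le (inf_le_left.trans (eqV_comm x y).le)) inf_le_right
    have hψx : eqV x y ⊓ (φ x ⇨ ψ x) ⊓ φ y ≤ ψ x :=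
      le_of_le_himp (inf_le_of_left_le inf_le_right) hφx
    exact le_himp_iff.2 (hψ.le_of_le_eqV (inf_le_of_left_le inf_le_left) hψx)

@[fun_prop]
protected theorem iInf {ι : Sort*} {φ : Name.{u, v} H → ι → H}
    (hφ : ∀ i, ExtPred fun x => φ x i) : ExtPred fun x => ⨅ i, φ x i := fun _ _ =>
  le_iInf fun i => (hφ i).le_of_le_eqV inf_le_left (inf_le_of_right_le (iInf_le _ i))

@[fun_prop]
protected theorem iSup {ι : Sort*} {φ : Name.{u, v} H → ι → H}
    (hφ : ∀ i, ExtPred fun x => φ x i) : ExtPred fun x => ⨆ i, φ x i := fun x y => by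
  rw [inf_iSup_eq]
  exact iSup_mono fun i => hφ i x y

end ExtPred

section ExtPred

variable {f g h : Name.{u, v} H → Name.{u, v} H}

@[fun_prop]
theorem extPred_iffV {φ ψ : Name.{u, v} H → H} (hφ : ExtPred φ) (hψ : ExtPred ψ) :
    ExtPred fun x => iffV (φ x) (ψ x) := by
  unfold iffV; fun_prop

@[fun_prop]
theorem extPred_eqV (hf : ExtFun f) (hg : ExtFun g) : ExtPred fun x => eqV (f x) (g x) :=
  fun x y =>
    calc eqV x y ⊓ eqV (f x) (g x)
        ≤ eqV (f y) (f x) ⊓ eqV (f x) (g x) ⊓ eqV (g x) (g y) :=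
          le_inf (inf_le_inf_right _ ((hf x y).trans (eqV_comm _ _).le))
            (inf_le_of_left_le (hg x y))
      _ ≤ eqV (f y) (g x) ⊓ eqV (g x) (g y) := inf_le_inf_right _ (eqV_inf_eqV_le _ _ _)
      _ ≤ eqV (f y) (g y) := eqV_inf_eqV_le _ _ _

theorem extPred_memV_left (a : Name.{u, v} H) : ExtPred fun x => memV x a := by
  simp only [memV_eq_iSup]; fun_prop

theorem extPred_memV_right (a : Name.{u, v} H) : ExtPred fun x => memV a x := fun x y =>
  calc eqV x y ⊓ memV a x
      = ⨆ i, eqV x y ⊓ x.val i ⊓ eqV a (x.elt i) := by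
        simp only [memV_eq_iSup, inf_iSup_eq, inf_assoc]
    _ ≤ ⨆ i, eqV (x.elt i) a ⊓ memV (x.elt i) y := iSup_mono fun i => by
        rw [inf_comm, eqV_comm]
        exact inf_le_inf_left _ (eqV_inf_val_le x y i)
    _ ≤ memV a y := iSup_le fun i => extPred_memV_left y _ _

@[fun_prop]
theorem extPred_memV (hf : ExtFun f) (hg : ExtFun g) : ExtPred fun x => memV (f x) (g x) :=
  fun x y => (extPred_memV_left _).le_of_le_eqV (inf_le_of_left_le (hf x y))
    ((extPred_memV_right _).le_of_le_eqV (inf_le_of_left_le (hg x y)) inf_le_right)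

@[fun_prop]
theorem extPred_allIn {φ : Name.{u, v} H → Name.{u, v} H → H} (hf : ExtFun f)
    (hφ : ∀ z, ExtPred fun x => φ x z) : ExtPred fun x => allIn (f x) (φ x) := by
  unfold allIn; fun_prop

@[fun_prop]
theorem extPred_exIn {φ : Name.{u, v} H → Name.{u, v} H → H} (hf : ExtFun f)
    (hφ : ∀ z, ExtPred fun x => φ x z) : ExtPred fun x => exIn (f x) (φ x) := by
  unfold exIn; fun_prop

@[fun_prop]
theorem extPred_isPair (hf : ExtFun f) (hg : ExtFun g) (hh : ExtFun h) :
    ExtPred fun x => isPair (f x) (g x) (h x) := by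
  unfold isPair isUPair; fun_prop

@[fun_prop]
theorem extPred_appV (hf : ExtFun f) (hg : ExtFun g) (hh : ExtFun h) :
    ExtPred fun x => appV (f x) (g x) (h x) := by
  unfold appV; fun_prop

@[fun_prop]
theorem extPred_isSucc (hf : ExtFun f) (hg : ExtFun g) :
    ExtPred fun x => isSucc (f x) (g x) := by
  unfold isSucc; fun_prop

@[fun_prop]
theorem extPred_leV (hf : ExtFun f) (hg : ExtFun g) : ExtPred fun x => leV (f x) (g x) := by
  unfold leV; fun_prop

@[fun_prop]
theorem extPred_mulLt (hf : ExtFun f) (hg : ExtFun g) (hh : ExtFun h) :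
    ExtPred fun x => mulLt (f x) (g x) (h x) := by
  unfold mulLt; fun_prop

theorem extPred_value {n : ℕ} (φ : SetFormula n) {w : Name.{u, v} H → Fin n → Name.{u, v} H}
    (hw : ∀ i, ExtFun fun x => w x i) : ExtPred fun x => φ.value (w x) := by
  induction φ with
  | mem i j => exact extPred_memV (hw i) (hw j)
  | eq i j => exact extPred_eqV (hw i) (hw j)
  | bot => exact ExtPred.const ⊥
  | and φ ψ hφ hψ => exact (hφ hw).inf (hψ hw)
  | or φ ψ hφ hψ => exact (hφ hw).sup (hψ hw)
  | imp φ ψ hφ hψ => exact (hφ hw).himp (hψ hw)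
  | all φ hφ => exact .iInf fun z => hφ (Fin.cases (ExtFun.const z) hw)
  | ex φ hφ => exact .iSup fun z => hφ (Fin.cases (ExtFun.const z) hw)

theorem extPred_relOf {n : ℕ} (φ : SetFormula (n + 2)) (w : Fin n → Name.{u, v} H)
    (x : Name.{u, v} H) : ExtPred (relOf φ w x) :=
  extPred_value φ (Fin.cases (ExtFun.const x) (Fin.cases ExtFun.id fun i => ExtFun.const (w i)))

end ExtPred

theorem iSup_eqV_inf {φ : Name.{u, v} H → H} (hφ : ExtPred φ) (a : Name.{u, v} H) :
    ⨆ z, eqV z a ⊓ φ z = φ a :=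
  le_antisymm (iSup_le fun z => hφ z a) (le_iSup_of_le a (by rw [eqV_self, top_inf_eq]))

theorem iInf_eqV_himp {φ : Name.{u, v} H → H} (hφ : ExtPred φ) (a : Name.{u, v} H) :
    ⨅ z, (eqV z a ⇨ φ z) = φ a := by
  refine le_antisymm ((iInf_le _ a).trans (by rw [eqV_self, top_himp])) (le_iInf fun z => ?_)
  rw [le_himp_iff, inf_comm, eqV_comm]
  exact hφ a z

theorem allIn_eq_iInf {φ : Name.{u, v} H → H} (hφ : ExtPred φ) (A : Name.{u, v} H) :
    allIn A φ = ⨅ i, A.val i ⇨ φ (A.elt i) :=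
  calc allIn A φ = ⨅ i, ⨅ z, (eqV z (A.elt i) ⇨ (A.val i ⇨ φ z)) := by
        simp only [allIn, memV_eq_iSup, iSup_himp_eq, himp_himp, inf_comm]
        exact iInf_comm
    _ = ⨅ i, A.val i ⇨ φ (A.elt i) :=
        iInf_congr fun i => iInf_eqV_himp (φ := fun z => A.val i ⇨ φ z) (by fun_prop) _

theorem exIn_eq_iSup {φ : Name.{u, v} H → H} (hφ : ExtPred φ) (A : Name.{u, v} H) :
    exIn A φ = ⨆ i, A.val i ⊓ φ (A.elt i) :=
  calc exIn A φ = ⨆ i, ⨆ z, eqV z (A.elt i) ⊓ (A.val i ⊓ φ z) := by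
        simp only [exIn, memV_eq_iSup, iSup_inf_eq, inf_assoc, inf_left_comm]
        exact iSup_comm
    _ = ⨆ i, A.val i ⊓ φ (A.elt i) :=
        iSup_congr fun i => iSup_eqV_inf (φ := fun z => A.val i ⊓ φ z) (by fun_prop) _

theorem eqV_eq_subsetV_inf_subsetV (x y : Name.{u, v} H) :
    eqV x y = subsetV x y ⊓ subsetV y x := by
  rw [eqV_eq_iInf_memV, subsetV, subsetV, allIn_eq_iInf (by fun_prop),
    allIn_eq_iInf (by fun_prop)]

theorem eqV_eq_iInf_iffV (x y : Name.{u, v} H) :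
    eqV x y = ⨅ w, iffV (memV w x) (memV w y) := by
  simp only [eqV_eq_subsetV_inf_subsetV, subsetV, allIn, iffV, iInf_inf_eq]

theorem eqV_eq_top {x y : Name.{u, v} H} (h : ∀ w, memV w x = memV w y) : eqV x y = ⊤ := by
  simp only [eqV_eq_iInf_iffV, h, iffV_self, iInf_top]

/-! ### Pairs and ground-model sets -/

/-- The name of the unordered pair of two names, which gives `isUPair` a closed form. -/
def upairN (x y : Name.{u, v} H) : Name.{u, v} H :=
  Name.mk (ULift Bool) (fun b => cond b.down x y) fun _ => ⊤

/-- The name of the Kuratowski pair of two names, which gives `isPair` a closed form. -/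
def pairN (x y : Name.{u, v} H) : Name.{u, v} H := upairN (upairN x x) (upairN x y)

theorem memV_upairN (w x y : Name.{u, v} H) : memV w (upairN x y) = eqV w x ⊔ eqV w y := by
  simp only [upairN, memV, iSup_ulift, iSup_bool_eq, top_inf_eq, cond_true, cond_false]

theorem subsetV_upairN (x y z : Name.{u, v} H) :
    subsetV (upairN x y) z = memV x z ⊓ memV y z := by
  rw [subsetV, allIn_eq_iInf (by fun_prop)]
  simp only [upairN, Name.idx, Name.elt, Name.val, iInf_ulift, iInf_bool_eq, top_himp,
    cond_true, cond_false]

theorem isUPair_eq (z x y : Name.{u, v} H) : isUPair z x y = eqV z (upairN x y) := by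
  simp only [isUPair, eqV_eq_iInf_iffV z, memV_upairN]

theorem isPair_eq (z x y : Name.{u, v} H) : isPair z x y = eqV z (pairN x y) := by
  simp only [isPair, eqV_eq_iInf_iffV z, pairN, memV_upairN, isUPair_eq]

theorem appV_eq (F x y : Name.{u, v} H) : appV F x y = memV (pairN x y) F := by
  simp only [appV, isPair_eq]
  exact iSup_eqV_inf (by fun_prop) _

theorem eqV_upairN (x y x' y' : Name.{u, v} H) : eqV (upairN x y) (upairN x' y') =
    eqV x x' ⊓ eqV y y' ⊔ eqV x y' ⊓ eqV y x' := by
  simp only [eqV_eq_subsetV_inf_subsetV (upairN x y), subsetV_upairN, memV_upairN,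
    eqV_comm x' _, eqV_comm y' _]
  set a := eqV x x'
  set b := eqV x y'
  set c := eqV y x'
  set d := eqV y y'
  calc (a ⊔ b) ⊓ (c ⊔ d) ⊓ ((a ⊔ c) ⊓ (b ⊔ d))
      = (a ⊔ b) ⊓ (a ⊔ c) ⊓ ((d ⊔ b) ⊓ (d ⊔ c)) := by
        rw [sup_comm c d, sup_comm b d]; ac_rfl
    _ = (a ⊔ b ⊓ c) ⊓ (d ⊔ b ⊓ c) := by rw [sup_inf_left, sup_inf_left]
    _ = a ⊓ d ⊔ b ⊓ c := sup_inf_right _ _ _ |>.symm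

theorem eqV_pairN (x y x' y' : Name.{u, v} H) :
    eqV (pairN x y) (pairN x' y') = eqV x x' ⊓ eqV y y' := by
  have hdegenerate : eqV x x' ⊓ (eqV x y' ⊓ eqV y x') ≤ eqV y y' :=
    calc eqV x x' ⊓ (eqV x y' ⊓ eqV y x')
        = eqV y x' ⊓ eqV x' x ⊓ eqV x y' := by
          rw [eqV_comm x' x]; ac_rfl
      _ ≤ eqV y x ⊓ eqV x y' := inf_le_inf_right _ (eqV_inf_eqV_le _ _ _)
      _ ≤ eqV y y' := eqV_inf_eqV_le _ _ _
  -- the second disjunct of each equality of unordered pairs forces all components to be equal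
  simp only [pairN, eqV_upairN, inf_idem, sup_idem, inf_comm (eqV x y') (eqV x x'),
    ← inf_inf_distrib_left]
  rw [inf_sup_left, inf_left_idem, sup_assoc, sup_idem]
  exact sup_eq_left.2 (le_inf inf_le_left hdegenerate)

theorem memV_check (w : Name.{u, v} H) (x : PSet.{u}) :
    memV w (check x) = ⨆ i, eqV w (check (x.Func i)) := by
  cases x
  simp only [check, memV, top_inf_eq]
  rfl

theorem allIn_check {φ : Name.{u, v} H → H} (hφ : ExtPred φ) (x : PSet.{u}) :
    allIn (check x) φ = ⨅ i, φ (check (x.Func i)) := by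
  rw [allIn_eq_iInf hφ]
  cases x
  simp only [check, Name.val, Name.elt, top_himp]
  rfl

theorem exIn_check {φ : Name.{u, v} H → H} (hφ : ExtPred φ) (x : PSet.{u}) :
    exIn (check x) φ = ⨆ i, φ (check (x.Func i)) := by
  rw [exIn_eq_iSup hφ]
  cases x
  simp only [check, Name.val, Name.elt, top_inf_eq]
  rfl

theorem memV_check_empty (w : Name.{u, v} H) : memV w (check ∅) = ⊥ := by
  rw [memV_check]
  exact iSup_of_empty _

theorem memV_check_insert (w : Name.{u, v} H) (x y : PSet.{u}) :
    memV w (check (insert x y)) = eqV w (check x) ⊔ memV w (check y) := by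
  rw [memV_check, memV_check]
  exact iSup_option _

theorem memV_check_singleton (w : Name.{u, v} H) (x : PSet.{u}) :
    memV w (check {x}) = eqV w (check x) := by
  rw [← LawfulSingleton.insert_empty_eq, memV_check_insert, memV_check_empty, sup_bot_eq]

theorem eqV_check_psPair (z : Name.{u, v} H) (x y : PSet.{u}) :
    eqV z (check (psPair x y)) = eqV z (pairN (check x) (check y)) := by
  have hsingleton : eqV (check {x}) (upairN (check x : Name.{u, v} H) (check x)) = ⊤ :=
    eqV_eq_top fun w => by rw [memV_check_singleton, memV_upairN, sup_idem]
  have hpair : eqV (check {x, y}) (upairN (check x : Name.{u, v} H) (check y)) = ⊤ :=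
    eqV_eq_top fun w => by rw [memV_check_insert, memV_check_singleton, memV_upairN]
  refine ExtPred.eq_of_eqV_eq_top (φ := eqV z) (by fun_prop) (eqV_eq_top fun w => ?_)
  rw [psPair, memV_check_insert, memV_check_singleton, pairN, memV_upairN,
    ExtPred.eq_of_eqV_eq_top (φ := eqV w) (by fun_prop) hsingleton,
    ExtPred.eq_of_eqV_eq_top (φ := eqV w) (by fun_prop) hpair]

/-! ### Natural numbers and functions on them -/

/-- The canonical name of a natural number, encoded as the von Neumann ordinal `PSet.ofNat n`. -/
abbrev natN (n : ℕ) : Name.{u, v} H := check (PSet.ofNat n)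

theorem memV_natN_succ (w : Name.{u, v} H) (n : ℕ) :
    memV w (natN (n + 1)) = eqV w (natN n) ⊔ memV w (natN n) :=
  memV_check_insert w _ _

theorem memV_natN (w : Name.{u, v} H) (n : ℕ) :
    memV w (natN n) = ⨆ (m) (_ : m < n), eqV w (natN m) := by
  induction n with
  | zero =>
    simp only [not_lt_zero, iSup_false, iSup_bot]
    exact memV_check_empty w
  | succ n ih => rw [memV_natN_succ, ih, Nat.iSup_lt_succ, sup_comm]

theorem memV_natN_of_lt {m n : ℕ} (h : m < n) :
    memV (natN m) (natN n : Name.{u, v} H) = ⊤ := by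
  rw [memV_natN]
  exact top_le_iff.1 (le_iSup₂_of_le m h (eqV_self _).ge)

theorem eqV_natN_of_lt {m n : ℕ} (h : m < n) : eqV (natN m) (natN n : Name.{u, v} H) = ⊥ := by
  induction m using Nat.strong_induction_on generalizing n with
  | _ m ih =>
    have hmem : eqV (natN m) (natN n : Name.{u, v} H) ≤ memV (natN m) (natN m) :=
      (extPred_memV_right _).le_of_le_eqV (eqV_comm _ _).le (le_top.trans (memV_natN_of_lt h).ge)
    refine le_bot_iff.1 (hmem.trans ?_)
    rw [memV_natN]
    exact iSup₂_le fun k hk => by rw [eqV_comm, ih k hk hk]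

theorem eqV_natN_of_ne {m n : ℕ} (h : m ≠ n) : eqV (natN m) (natN n : Name.{u, v} H) = ⊥ :=
  h.lt_or_gt.elim eqV_natN_of_lt fun h => by rw [eqV_comm, eqV_natN_of_lt h]

theorem leV_natN_of_lt {m n : ℕ} (h : m < n) : leV (natN n) (natN m : Name.{u, v} H) = ⊥ := by
  simp only [leV, memV_natN, eqV_natN_of_ne h.ne', sup_bot_eq, iSup_eq_bot]
  exact fun k hk => eqV_natN_of_ne (hk.trans h).ne'

theorem isSucc_natN (z : Name.{u, v} H) (n : ℕ) : isSucc z (natN n) = eqV z (natN (n + 1)) := by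
  simp only [isSucc, eqV_eq_iInf_iffV z, memV_natN_succ, sup_comm]

theorem memV_omegaN (w : Name.{u, v} H) : memV w omegaN = ⨆ n, eqV w (natN n) := by
  rw [omegaN, memV_check]
  exact iSup_ulift _

theorem allIn_omegaN {φ : Name.{u, v} H → H} (hφ : ExtPred φ) :
    allIn omegaN φ = ⨅ n, φ (natN n) := by
  rw [omegaN, allIn_check hφ]
  exact iInf_ulift _

theorem exIn_omegaN {φ : Name.{u, v} H → H} (hφ : ExtPred φ) :
    exIn omegaN φ = ⨆ n, φ (natN n) := by
  rw [omegaN, exIn_check hφ]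
  exact iSup_ulift _

theorem mulLt_natN_of_lt {k l n : ℕ} (h : k * l < n) :
    mulLt (natN k) (natN l) (natN n : Name.{u, v} H) = ⊤ := by
  have hgraph : appV (check mulGraph) (pairN (natN k) (natN l))
      (natN (k * l) : Name.{u, v} H) = ⊤ := by
    rw [appV_eq, memV_check]
    refine top_le_iff.1 (le_iSup_of_le ⟨(k, l)⟩ ?_)
    simp only [mulGraph, PSet.Func, eqV_check_psPair, eqV_pairN, eqV_self, inf_idem, le_refl]
  refine top_le_iff.1 (le_iSup₂_of_le (pairN (natN k) (natN l)) (natN (k * l)) ?_)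
  rw [isPair_eq, eqV_self, hgraph, memV_natN_of_lt h, inf_idem, inf_idem]

theorem isFun_inf_appV_le (F A B x y : Name.{u, v} H) :
    isFun F A B ⊓ appV F x y ≤ memV y B :=
  le_himp_iff.1 (inf_le_right.trans ((iInf_le _ x).trans (iInf_le _ y)))

/-- `F` is, up to equality in the model, the name `{⟨(k_i, y_i), v_i⟩ : i ∈ ι}` of a relation
between natural numbers `k_i` and names `y_i`. -/
def HasGraph {ι : Type*} (F : Name.{u, v} H) (k : ι → ℕ) (y : ι → Name.{u, v} H)
    (v : ι → H) : Prop :=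
  ∀ z, memV z F = ⨆ i, v i ⊓ eqV z (pairN (natN (k i)) (y i))

namespace HasGraph

variable {ι : Type*} {F : Name.{u, v} H} {k : ι → ℕ} {y : ι → Name.{u, v} H} {v : ι → H}

theorem appV_eq_iSup (hF : HasGraph F k y v) (x z : Name.{u, v} H) :
    appV F x z = ⨆ i, v i ⊓ (eqV x (natN (k i)) ⊓ eqV z (y i)) := by
  simp only [appV_eq, hF (pairN x z), eqV_pairN]

theorem le_appV (hF : HasGraph F k y v) (i : ι) : v i ≤ appV F (natN (k i)) (y i) := by
  rw [hF.appV_eq_iSup]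
  exact le_iSup_of_le i (by rw [eqV_self, eqV_self, inf_idem, inf_top_eq])

theorem exIn_omegaN_appV (hF : HasGraph F k y v) (z : Name.{u, v} H) :
    (exIn omegaN fun x => appV F x z) = ⨆ i, v i ⊓ eqV z (y i) := by
  rw [exIn_omegaN (by fun_prop)]
  refine le_antisymm (iSup_le fun n => ?_) (iSup_le fun i => le_iSup_of_le (k i) ?_)
  · rw [hF.appV_eq_iSup]
    exact iSup_mono fun i => inf_le_inf_left _ inf_le_right
  · exact ExtPred.le_of_le_eqV (φ := fun z => appV F (natN (k i)) z) (by fun_prop)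
      (inf_le_right.trans (eqV_comm _ _).le) (inf_le_of_left_le (hF.le_appV i))

theorem appV_inf_appV_le (hF : HasGraph F k y v)
    (hunique : ∀ i j, k i = k j → v i ⊓ v j ≤ eqV (y i) (y j)) (x z z' : Name.{u, v} H) :
    appV F x z ⊓ appV F x z' ≤ eqV z z' := by
  rw [hF.appV_eq_iSup, hF.appV_eq_iSup, iSup_inf_iSup]
  refine iSup_le fun ⟨i, j⟩ => ?_
  calc v i ⊓ (eqV x (natN (k i)) ⊓ eqV z (y i)) ⊓ (v j ⊓ (eqV x (natN (k j)) ⊓ eqV z' (y j)))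
      = eqV (natN (k i)) x ⊓ eqV x (natN (k j)) ⊓ (v i ⊓ v j) ⊓ (eqV z (y i) ⊓ eqV (y j) z') := by
        rw [eqV_comm x (natN (k i)), eqV_comm z']; ac_rfl
    _ ≤ eqV (y i) (y j) ⊓ (eqV z (y i) ⊓ eqV (y j) z') := by
        refine inf_le_inf_right _ ?_
        by_cases hij : k i = k j
        · exact inf_le_of_right_le (hunique i j hij)
        · refine inf_le_of_left_le ((eqV_inf_eqV_le _ _ _).trans ?_)
          rw [eqV_natN_of_ne hij]
          exact bot_le
    _ = eqV z (y i) ⊓ eqV (y i) (y j) ⊓ eqV (y j) z' := by ac_rfl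
    _ ≤ eqV z z' := (inf_le_inf_right _ (eqV_inf_eqV_le _ _ _)).trans (eqV_inf_eqV_le _ _ _)

theorem isFunOn_omegaN (hF : HasGraph F k y v) (htotal : ∀ n, ⨆ (i) (_ : k i = n), v i = ⊤)
    (hunique : ∀ i j, k i = k j → v i ⊓ v j ≤ eqV (y i) (y j)) : isFunOn F omegaN = ⊤ := by
  refine inf_eq_top_iff.2 ⟨inf_eq_top_iff.2 ⟨?_, ?_⟩, ?_⟩
  · refine iInf_eq_top.2 fun z => himp_eq_top_iff.2 ?_
    simp only [hF z]
    rw [exIn_omegaN (by fun_prop)]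
    simp only [isPair_eq]
    exact iSup_le fun i => le_iSup₂_of_le (k i) (y i) inf_le_right
  · rw [allIn_omegaN (by fun_prop)]
    refine iInf_eq_top.2 fun n => top_le_iff.1 ((htotal n).ge.trans ?_)
    exact iSup₂_le fun i hi => le_iSup_of_le (y i) (hi ▸ hF.le_appV i)
  · exact iInf_eq_top.2 fun x => iInf_eq_top.2 fun z => iInf_eq_top.2 fun z' =>
      himp_eq_top_iff.2 (hF.appV_inf_appV_le hunique x z z')

theorem le_isFun_omegaN (hF : HasGraph F k y v) {A : Name.{u, v} H} {c : H}
    (hfun : c ≤ isFunOn F omegaN) (hmaps : ∀ i, c ⊓ v i ≤ memV (y i) A) :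
    c ≤ isFun F omegaN A := by
  refine le_inf hfun (le_iInf₂ fun x z => le_himp_iff.2 ?_)
  rw [hF.appV_eq_iSup, inf_iSup_eq]
  refine iSup_le fun i => (extPred_memV_left A).le_of_le_eqV (x := y i) ?_ ?_
  · rw [eqV_comm (y i)]
    exact inf_le_of_right_le (inf_le_of_right_le inf_le_right)
  · exact (inf_le_inf_left c inf_le_left).trans (hmaps i)

end HasGraph

/-- The name of the function on the natural numbers whose values are the names `s_n`. -/
def seqN (s : ℕ → Name.{u, v} H) : Name.{u, v} H :=
  Name.mk (ULift ℕ) (fun n => pairN (natN n.down) (s n.down)) fun _ => ⊤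

theorem hasGraph_seqN (s : ℕ → Name.{u, v} H) : HasGraph (seqN s) id s fun _ => ⊤ := fun _ =>
  iSup_ulift _

theorem appV_seqN (s : ℕ → Name.{u, v} H) (n : ℕ) : appV (seqN s) (natN n) (s n) = ⊤ :=
  top_le_iff.1 ((hasGraph_seqN s).le_appV n)

theorem isFunOn_seqN (s : ℕ → Name.{u, v} H) : isFunOn (seqN s) omegaN = ⊤ :=
  (hasGraph_seqN s).isFunOn_omegaN (fun n => top_le_iff.1 (le_iSup₂_of_le n rfl le_rfl))
    fun i j hij => le_top.trans (by rw [show i = j from hij, eqV_self])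

/-! ### Dependent choice and the maximum principle -/

theorem le_isChain_seqN {φ : Name.{u, v} H → Name.{u, v} H → H} {s : ℕ → Name.{u, v} H} {c : H}
    (hs : ∀ n, c ≤ φ (s n) (s (n + 1))) : c ≤ isChain φ (s 0) (seqN s) := by
  refine le_inf (le_inf ?_ ?_) ?_
  · exact le_top.trans (isFunOn_seqN s).ge
  · exact le_top.trans (appV_seqN s 0).ge
  · rw [allIn_omegaN (by fun_prop)]
    refine le_iInf fun n => ?_
    simp only [isSucc_natN]
    rw [iInf_eqV_himp (by fun_prop)]
    refine le_iSup₂_of_le (s n) (s (n + 1)) ?_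
    rw [appV_seqN, appV_seqN, inf_idem, top_inf_eq]
    exact hs n

/-- The maximum principle: the truth value of every existential statement is the truth value of
one of its instances. -/
def MaximumPrinciple (H : Type v) [Order.Frame H] : Prop :=
  ∀ φ : Name.{u, v} H → H, ExtPred φ → ∃ y, ⨆ z, φ z = φ y

theorem MaximumPrinciple.dcClass_eq_top (hH : MaximumPrinciple.{u} H)
    {φ : Name.{u, v} H → Name.{u, v} H → H} (hφ : ∀ x, ExtPred (φ x)) : dcClass φ = ⊤ := by
  choose next hnext using fun x => hH (φ x) (hφ x)
  refine himp_eq_top_iff.2 (le_iInf fun x₀ => le_iSup_of_le (seqN fun n => next^[n] x₀) ?_)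
  refine le_isChain_seqN (s := fun n => next^[n] x₀) fun n => ?_
  rw [Function.iterate_succ_apply', ← hnext]
  exact iInf_le _ _

theorem MaximumPrinciple.dcSet_eq_top (hH : MaximumPrinciple.{u} H)
    {φ : Name.{u, v} H → Name.{u, v} H → H} (hφ : ∀ x, ExtPred (φ x)) : dcSet φ = ⊤ := by
  choose next hnext using fun A x =>
    hH (fun y => memV y A ⊓ φ x y) ((extPred_memV_left A).inf (hφ x))
  refine iInf_eq_top.2 fun A => himp_eq_top_iff.2 (le_iInf fun x₀ => le_himp_iff.2 ?_)
  set s : ℕ → Name.{u, v} H := fun n => (next A)^[n] x₀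
  set c : H := (allIn A fun x => exIn A fun y => φ x y) ⊓ memV x₀ A
  have hstep (n : ℕ) (hn : c ≤ memV (s n) A) :
      c ≤ memV (s (n + 1)) A ⊓ φ (s n) (s (n + 1)) := by
    have hex : c ≤ exIn A (φ (s n)) :=
      le_of_le_himp (inf_le_of_left_le (iInf_le _ (s n))) hn
    rwa [exIn, hnext A (s n), ← Function.iterate_succ_apply' (next A)] at hex
  have hmem (n : ℕ) : c ≤ memV (s n) A := by
    induction n with
    | zero => exact inf_le_right
    | succ n ih => exact (hstep n ih).trans inf_le_left
  have hfun : c ≤ isFun (seqN s) omegaN A :=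
    (hasGraph_seqN s).le_isFun_omegaN (le_top.trans (isFunOn_seqN s).ge)
      fun n => inf_le_of_left_le (hmem n)
  exact le_iSup_of_le (seqN s)
    (le_inf hfun (le_isChain_seqN fun n => (hstep n (hmem n)).trans inf_le_right))

/-- The mixture of the names `z_i` with respect to truth values `D_i`: where `D_i` holds and the
other `D_j` do not, it equals `z_i`. -/
def mixN {ι : Type u} (D : ι → H) (z : ι → Name.{u, v} H) : Name.{u, v} H :=
  Name.mk (Σ i, (z i).idx) (fun p => (z p.1).elt p.2) fun p => D p.1 ⊓ (z p.1).val p.2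

theorem memV_mixN {ι : Type u} (D : ι → H) (z : ι → Name.{u, v} H) (w : Name.{u, v} H) :
    memV w (mixN D z) = ⨆ i, D i ⊓ memV w (z i) := by
  simp only [memV_eq_iSup, inf_iSup_eq, ← inf_assoc]
  exact iSup_sigma

theorem le_eqV_mixN {ι : Type u} {D : ι → H} (hD : Pairwise (Function.onFun Disjoint D))
    (z : ι → Name.{u, v} H) (i : ι) : D i ≤ eqV (mixN D z) (z i) := by
  simp only [eqV_eq_iInf_iffV, memV_mixN]
  refine le_iInf fun w => le_inf (le_himp_iff.2 ?_) (le_himp_iff.2 ?_)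
  · rw [inf_iSup_eq]
    refine iSup_le fun j => ?_
    obtain rfl | hij := eq_or_ne i j
    · exact inf_le_of_right_le inf_le_right
    · rw [← inf_assoc, (hD hij).eq_bot, bot_inf_eq]
      exact bot_le
  · exact le_iSup_of_le i le_rfl

end Semantics

section MaximumPrinciple

variable {X : Type v} [TopologicalSpace X] [HereditarilyLindelofSpace X]

theorem exists_pairwise_disjoint_opens_iSup_eq (hX : IsTopologicalBasis {s : Set X | IsClopen s})
    {ι : Type*} [Nonempty ι] (O : ι → Opens X) :
    ∃ (D : ℕ → Opens X) (t : ℕ → ι), Pairwise (Function.onFun Disjoint D) ∧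
      (∀ n, D n ≤ O (t n)) ∧ ⨆ n, D n = ⨆ i, O i := by
  let κ := {q : Set X × ι // IsClopen q.1 ∧ q.1 ⊆ O q.2}
  have : Nonempty κ := ⟨⟨(∅, Classical.arbitrary ι), isClopen_empty, empty_subset _⟩⟩
  obtain ⟨q, hq⟩ := eq_open_union_nat (fun q : κ => q.1.1) fun q => q.2.1.isOpen
  let s (n : ℕ) : Set X := (q n).1.1
  have hclopen (n : ℕ) : IsClopen (disjointed s n) :=
    disjointedRec (fun _ i ht => ht.diff (q i).2.1) (q n).2.1
  refine ⟨fun n => ⟨disjointed s n, (hclopen n).isOpen⟩, fun n => (q n).1.2, fun m n hmn => ?_,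
    fun n => (disjointed_subset s n).trans (q n).2.2, le_antisymm ?_ ?_⟩
  · rw [Function.onFun, ← Opens.coe_disjoint]
    exact disjoint_disjointed s hmn
  · exact iSup_le fun n => le_iSup_of_le (q n).1.2 ((disjointed_subset s n).trans (q n).2.2)
  · refine iSup_le fun i x hx => ?_
    obtain ⟨c, hc, hxc, hcO⟩ := hX.exists_subset_of_mem_open hx (O i).isOpen
    have hxs : x ∈ ⋃ n, s n := hq ▸ mem_iUnion.2 ⟨(⟨(c, i), hc, hcO⟩ : κ), hxc⟩
    rw [← iUnion_disjointed] at hxs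
    exact Opens.mem_iSup.2 (mem_iUnion.1 hxs)

theorem maximumPrinciple_opens (hX : IsTopologicalBasis {s : Set X | IsClopen s}) :
    MaximumPrinciple.{u} (Opens X) := fun φ hφ => by
  have : Nonempty (Name.{u, v} (Opens X)) := ⟨check ∅⟩
  obtain ⟨D, t, hdisj, hle, hsup⟩ := exists_pairwise_disjoint_opens_iSup_eq hX φ
  have hdisj' : Pairwise (Function.onFun Disjoint fun n : ULift.{u} ℕ => D n.down) := fun m n hmn =>
    hdisj fun h => hmn (ULift.ext _ _ h)
  let y := mixN (fun n : ULift.{u} ℕ => D n.down) fun n => t n.down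
  refine ⟨y, le_antisymm (hsup ▸ iSup_le fun n => ?_) (le_iSup φ y)⟩
  refine hφ.le_of_le_eqV (x := t n) ?_ (hle n)
  rw [eqV_comm]
  exact le_eqV_mixN hdisj' _ ⟨n⟩

end MaximumPrinciple

/-! ### Topology of the space of functions with finite range -/

theorem exists_forall_apply_le (f : T) : ∃ B, ∀ n, f.1 n ≤ B :=
  f.2.bddAbove.imp fun _ hB n => hB ⟨n, rfl⟩

theorem continuous_eval (n : ℕ) : Continuous fun f : T => f.1 n :=
  continuous_discrete_rng.2 (isOpen_value n)

/-- The functions in `T` that are pointwise at most `h`. This set is compact for constant `h` and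
open for `h` tending to infinity. -/
def boundSet (h : ℕ → ℕ) : Set T := {f | ∀ n, f.1 n ≤ h n}

namespace Cond

theorem isOpen_toSet (p : Cond) : IsOpen p.toSet := isOpen_generateFrom_of_mem ⟨p, rfl⟩

theorem isClosed_toSet (p : Cond) : IsClosed p.toSet := by
  simp only [toSet, ofPred_and, ofPred_forall]
  exact (isClosed_iInter fun n => isClosed_iInter fun _ =>
    (isClosed_discrete {p.g n}).preimage (continuous_eval n)).inter <|
    isClosed_iInter fun n => isClosed_iInter fun _ =>
      (isClosed_discrete (Iic (p.g n))).preimage (continuous_eval n)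

theorem tendsto_g (p : Cond) : Tendsto p.g atTop atTop := by
  refine tendsto_atTop_atTop.2 fun B => ?_
  obtain ⟨n, hn⟩ := p.unbounded B
  refine ⟨max n p.stem, fun m hm => ?_⟩
  obtain hnp | hnp := lt_or_ge n p.stem
  · exact hn.le.trans ((p.le_stem n hnp).trans (p.mono _ _ le_rfl ((le_max_right _ _).trans hm)))
  · exact hn.le.trans (p.mono _ _ hnp ((le_max_left _ _).trans hm))

theorem toSet_subset_boundSet (p : Cond) : p.toSet ⊆ boundSet p.g := fun _ hf n =>
  (lt_or_ge n p.stem).elim (fun h => (hf.1 n h).le) (hf.2 n)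

end Cond

theorem exists_monotone_le_tendsto_atTop {α β : Type*} [ConditionallyCompleteLattice α] [OrderBot α]
    [SemilatticeSup β] [Nonempty β] {h : β → α} (hh : Tendsto h atTop atTop) :
    ∃ e : β → α, Monotone e ∧ (∀ m, e m ≤ h m) ∧ Tendsto e atTop atTop := by
  refine ⟨fun m => ⨅ n : Ici m, h n, fun m m' hm => le_ciInf fun n => ?_,
    fun m => ciInf_le (OrderBot.bddBelow _) (⟨m, le_rfl⟩ : Ici m), ?_⟩
  · exact ciInf_le (OrderBot.bddBelow _) (⟨n, hm.trans n.2⟩ : Ici m)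
  · refine tendsto_atTop.2 fun C => ?_
    obtain ⟨M, hM⟩ := eventually_atTop.1 (hh.eventually_ge_atTop C)
    filter_upwards [eventually_ge_atTop M] with m hm
    exact le_ciInf fun n => hM n (hm.trans n.2)

/-- The condition which fixes the values of `f` below `s` and bounds the later ones by `e`, used to
find small basic neighbourhoods of `f`. -/
def Cond.ofMonotone (f e : ℕ → ℕ) (s : ℕ) (he : Monotone e) (htop : Tendsto e atTop atTop)
    (hfe : ∀ n, f n ≤ e s) : Cond where
  g n := if n < s then f n else e n
  stem := s
  unbounded B := by
    obtain ⟨n, hn, hBn⟩ := ((eventually_ge_atTop s).and (htop.eventually_gt_atTop B)).exists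
    exact ⟨n, hBn.trans_eq (if_neg hn.not_gt).symm⟩
  mono m n hm hmn := by
    rw [if_neg hm.not_gt, if_neg (hm.trans hmn).not_gt]
    exact he hmn
  le_stem i hi := by
    rw [if_pos hi, if_neg (lt_irrefl s)]
    exact hfe i

theorem exists_cond_subset_boundSet {h : ℕ → ℕ} (hh : Tendsto h atTop atTop) {f : T}
    (hf : f ∈ boundSet h) (N : ℕ) :
    ∃ p : Cond, f ∈ p.toSet ∧ p.toSet ⊆ boundSet h ∧
      ∀ f' ∈ p.toSet, ∀ n < N, f'.1 n = f.1 n := by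
  obtain ⟨B, hB⟩ := exists_forall_apply_le f
  obtain ⟨e, he, heh, htop⟩ := exists_monotone_le_tendsto_atTop hh
  obtain ⟨s, hNs, hBs⟩ := ((eventually_ge_atTop N).and (htop.eventually_ge_atTop B)).exists
  let p := Cond.ofMonotone f.1 e s he htop fun n => (hB n).trans hBs
  have hg_lt {n : ℕ} (hn : n < s) : p.g n = f.1 n := if_pos hn
  have hg_ge {n : ℕ} (hn : s ≤ n) : p.g n = e n := if_neg hn.not_gt
  refine ⟨p, ⟨fun n hn => (hg_lt hn).symm, fun n hn => ?_⟩, fun f' hf' n => ?_,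
    fun f' hf' n hn => ?_⟩
  · exact ((hB n).trans (hBs.trans (he hn))).trans_eq (hg_ge hn).symm
  · obtain hn | hn := lt_or_ge n s
    · exact ((hf'.1 n hn).trans (hg_lt hn)).trans_le (hf n)
    · exact (hf'.2 n hn).trans ((hg_ge hn).trans_le (heh n))
  · exact (hf'.1 n (hn.trans_le hNs)).trans (hg_lt (hn.trans_le hNs))

theorem isOpen_boundSet {h : ℕ → ℕ} (hh : Tendsto h atTop atTop) : IsOpen (boundSet h) :=
  isOpen_iff_forall_mem_open.2 fun _ hf =>
    have ⟨p, hfp, hp, _⟩ := exists_cond_subset_boundSet hh hf 0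
    ⟨p.toSet, hp, p.isOpen_toSet, hfp⟩

theorem isTopologicalBasis_range_toSet : IsTopologicalBasis (range Cond.toSet) where
  exists_subset_inter := by
    rintro _ ⟨p, rfl⟩ _ ⟨q, rfl⟩ f ⟨hfp, hfq⟩
    obtain ⟨r, hfr, hr, hagree⟩ := exists_cond_subset_boundSet (f := f)
      (tendsto_inf_atTop _ p.tendsto_g q.tendsto_g) (fun n => le_min
        (p.toSet_subset_boundSet hfp n) (q.toSet_subset_boundSet hfq n)) (max p.stem q.stem)
    refine ⟨r.toSet, ⟨r, rfl⟩, hfr, fun f' hf' => ⟨⟨fun n hn => ?_, fun n _ => ?_⟩,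
      ⟨fun n hn => ?_, fun n _ => ?_⟩⟩⟩
    · exact (hagree f' hf' n (lt_max_of_lt_left hn)).trans (hfp.1 n hn)
    · exact (hr hf' n).trans (min_le_left _ _)
    · exact (hagree f' hf' n (lt_max_of_lt_right hn)).trans (hfq.1 n hn)
    · exact (hr hf' n).trans (min_le_right _ _)
  sUnion_eq := eq_univ_of_forall fun f => by
    have htendsto : Tendsto (fun n => f.1 n + n) atTop atTop :=
      tendsto_atTop_mono (fun n => Nat.le_add_left n _) tendsto_id
    obtain ⟨p, hfp, -⟩ := exists_cond_subset_boundSet (f := f) htendsto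
      (fun n => Nat.le_add_right _ n) 0
    exact ⟨p.toSet, ⟨p, rfl⟩, hfp⟩
  eq_generateFrom := rfl

theorem isTopologicalBasis_isClopen : IsTopologicalBasis {s : Set T | IsClopen s} :=
  isTopologicalBasis_range_toSet.of_isOpen_of_subset (fun _ hs => hs.isOpen) <| by
    rintro _ ⟨p, rfl⟩
    exact ⟨p.isClosed_toSet, p.isOpen_toSet⟩

theorem dense_setOf_exists_lt (B : ℕ) : Dense {f : T | ∃ n, B < f.1 n} := by
  refine isTopologicalBasis_range_toSet.dense_iff.2 ?_
  rintro _ ⟨p, rfl⟩ ⟨f, hf⟩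
  obtain ⟨n, hpn, hn⟩ := ((eventually_ge_atTop p.stem).and
    (p.tendsto_g.eventually_gt_atTop B)).exists
  set e := Function.update f.1 n (p.g n)
  have he_self : e n = p.g n := Function.update_self ..
  have he_ne {m : ℕ} (hm : m ≠ n) : e m = f.1 m := Function.update_of_ne hm ..
  have hrange : (range e).Finite :=
    (f.2.insert (p.g n)).subset <| range_subset_iff.2 fun m =>
      (eq_or_ne m n).imp (fun h => (congrArg e h).trans he_self) fun h => ⟨m, (he_ne h).symm⟩
  refine ⟨⟨e, hrange⟩, ⟨fun m hm => ?_, fun m hm => ?_⟩, n, hn.trans_eq he_self.symm⟩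
  · exact (he_ne (hm.trans_le hpn).ne).trans (hf.1 m hm)
  · obtain rfl | hmn := eq_or_ne m n
    · exact he_self.le
    · exact (he_ne hmn).trans_le (hf.2 m hm)

/-- The inclusion of the Cantor space of functions bounded by `B` into `T`; its image is compact. -/
def ofFin (B : ℕ) (x : ℕ → Fin (B + 1)) : T :=
  ⟨fun n => x n, (finite_lt_nat (B + 1)).subset (range_subset_iff.2 fun n => (x n).2)⟩

theorem continuous_ofFin (B : ℕ) : Continuous (ofFin B) := by
  refine continuous_generateFrom_iff.2 ?_
  rintro _ ⟨p, rfl⟩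
  obtain ⟨N, hN⟩ := eventually_atTop.1
    ((eventually_ge_atTop p.stem).and (p.tendsto_g.eventually_ge_atTop B))
  have heq : ofFin B ⁻¹' p.toSet = ⋂ n ∈ Iio N, (fun x : ℕ → Fin (B + 1) => x n) ⁻¹'
      {i | (n < p.stem → (i : ℕ) = p.g n) ∧ (p.stem ≤ n → (i : ℕ) ≤ p.g n)} := by
    ext x
    simp only [mem_iInter, mem_preimage, mem_ofPred_eq, mem_Iio]
    refine ⟨fun hx n _ => ⟨hx.1 n, hx.2 n⟩, fun hx => ⟨fun n hn => ?_, fun n hn => ?_⟩⟩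
    · exact (hx n (not_le.1 fun h => (hN n h).1.not_gt hn)).1 hn
    · obtain h | h := lt_or_ge n N
      · exact (hx n h).2 hn
      · exact (Fin.is_le (x n)).trans (hN n h).2
  rw [heq]
  exact (finite_Iio N).isOpen_biInter fun n _ => (isOpen_discrete _).preimage (continuous_apply n)

theorem range_ofFin (B : ℕ) : range (ofFin B) = boundSet fun _ => B :=
  Subset.antisymm (range_subset_iff.2 fun x n => Fin.is_le (x n)) fun f hf =>
    ⟨fun n => ⟨f.1 n, Nat.lt_succ_of_le (hf n)⟩, rfl⟩

theorem isCompact_boundSet_const (B : ℕ) : IsCompact (boundSet fun _ => B) :=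
  range_ofFin B ▸ isCompact_range (continuous_ofFin B)

instance : HereditarilyLindelofSpace T where
  isHereditarilyLindelof_univ s _ := by
    have hs : s = ⋃ B, ofFin B '' (ofFin B ⁻¹' s) := by
      simp only [image_preimage_eq_inter_range, ← inter_iUnion, range_ofFin]
      refine (inter_eq_left.2 fun f _ => mem_iUnion.2 (exists_forall_apply_le f)).symm
    rw [hs]
    exact isLindelof_iUnion fun B =>
      (HereditarilyLindelofSpace.isLindelof _).image (continuous_ofFin B)

theorem maximumPrinciple_opens_T : MaximumPrinciple.{u} (Opens T) :=
  maximumPrinciple_opens isTopologicalBasis_isClopen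

/-- The truncation `min(f, B)`, a retraction of `T` onto the compact set of functions bounded by
`B`. -/
def trunc (B : ℕ) (f : T) : T :=
  ⟨fun n => min (f.1 n) B, (finite_Iic B).subset <|
    range_subset_iff.2 fun n => Nat.min_le_right (f.1 n) B⟩

theorem Cond.exists_mem_toSet_of_trunc_mem (p : Cond) (B : ℕ) :
    ∃ h : ℕ → ℕ, Tendsto h atTop atTop ∧ (∀ n, B ≤ h n) ∧
      ∀ f ∈ boundSet h, trunc B f ∈ p.toSet → f ∈ p.toSet := by
  refine ⟨fun n => if n < p.stem then B else max B (p.g n), ?_, fun n => ?_,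
    fun f hf hfp => ⟨fun n hn => ?_, fun n hn => ?_⟩⟩
  · refine tendsto_atTop_mono' _ ?_ p.tendsto_g
    filter_upwards [eventually_ge_atTop p.stem] with n hn
    exact (le_max_right B _).trans_eq (if_neg hn.not_gt).symm
  · dsimp only
    split_ifs
    exacts [le_rfl, le_max_left _ _]
  · have hfn : f.1 n ≤ B := (hf n).trans_eq (if_pos hn)
    exact (min_eq_left hfn).symm.trans (hfp.1 n hn)
  · have hfn : f.1 n ≤ max B (p.g n) := (hf n).trans_eq (if_neg hn.not_gt)
    have hmin : min (f.1 n) B ≤ p.g n := hfp.2 n hn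
    lia

theorem exists_boundSet_subset {W : Set T} (hW : IsOpen W) {B : ℕ}
    (hBW : (boundSet fun _ => B) ⊆ W) :
    ∃ h : ℕ → ℕ, Tendsto h atTop atTop ∧ (∀ n, B ≤ h n) ∧ boundSet h ⊆ W := by
  suffices hK : ∃ h : ℕ → ℕ, Tendsto h atTop atTop ∧ (∀ n, B ≤ h n) ∧
      ∀ f ∈ boundSet h, trunc B f ∈ boundSet (fun _ => B) → f ∈ W by
    obtain ⟨h, hh, hB, hhW⟩ := hK
    exact ⟨h, hh, hB, fun f hf => hhW f hf fun n => Nat.min_le_right (f.1 n) B⟩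
  refine (isCompact_boundSet_const B).induction_on (p := fun s => ∃ h : ℕ → ℕ,
    Tendsto h atTop atTop ∧ (∀ n, B ≤ h n) ∧ ∀ f ∈ boundSet h, trunc B f ∈ s → f ∈ W) ?_ ?_ ?_ ?_
  · exact ⟨(B + ·), tendsto_atTop_mono (Nat.le_add_left · B) tendsto_id, Nat.le_add_right B,
      fun _ _ => False.elim⟩
  · rintro s t hst ⟨h, hh, hB, ht⟩
    exact ⟨h, hh, hB, fun f hf hfs => ht f hf (hst hfs)⟩
  · rintro s t ⟨h, hh, hB, hs⟩ ⟨h', hh', hB', ht⟩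
    refine ⟨fun n => min (h n) (h' n), tendsto_inf_atTop _ hh hh',
      fun n => le_min (hB n) (hB' n), fun f hf => ?_⟩
    exact Or.rec (hs f fun n => (hf n).trans (min_le_left _ _))
      (ht f fun n => (hf n).trans (min_le_right _ _))
  · intro x hx
    obtain ⟨_, ⟨p, rfl⟩, hxp, hpW⟩ :=
      isTopologicalBasis_range_toSet.exists_subset_of_mem_open (hBW hx) hW
    obtain ⟨h, hh, hB, hhp⟩ := p.exists_mem_toSet_of_trunc_mem B
    exact ⟨p.toSet, mem_nhdsWithin_of_mem_nhds (p.isOpen_toSet.mem_nhds hxp), h, hh, hB,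
      fun f hf hfp => hpW (hhp f hf hfp)⟩

theorem tendsto_ciInf_atTop {α β ι : Type*} [ConditionallyCompleteLattice α] [Nonempty ι]
    {l : Filter β} {b : ι → α} {h : ι → β → α} (hb : Tendsto b cofinite atTop)
    (hbh : ∀ i x, b i ≤ h i x) (hh : ∀ i, Tendsto (h i) l atTop) :
    Tendsto (fun x => ⨅ i, h i x) l atTop := by
  refine tendsto_atTop.2 fun C => ?_
  have hfin : {i | ¬C ≤ b i}.Finite := eventually_cofinite.1 (tendsto_atTop.1 hb C)
  filter_upwards [hfin.eventually_all.2 fun i _ => tendsto_atTop.1 (hh i) C] with x hx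
  refine le_ciInf fun i => ?_
  by_cases hi : C ≤ b i
  exacts [hi.trans (hbh i x), hx i hi]

theorem exists_eventually_forall_ge_mem {W : ℕ → Set T} (hW : ∀ n, IsOpen (W n)) {b : ℕ → ℕ}
    (hb : Tendsto b atTop atTop) (hbW : ∀ n, (boundSet fun _ => b n) ⊆ W n) (f : T) :
    ∃ N, ∀ᶠ f' in 𝓝 f, ∀ n ≥ N, f' ∈ W n := by
  choose h hh hbh hhW using fun n => exists_boundSet_subset (hW n) (hbW n)
  obtain ⟨B, hB⟩ := exists_forall_apply_le f
  obtain ⟨N, hN⟩ := eventually_atTop.1 (hb.eventually_ge_atTop B)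
  have hinf : Tendsto (fun m => ⨅ i, h (i + N) m) atTop atTop :=
    tendsto_ciInf_atTop (Nat.cofinite_eq_atTop ▸ hb.comp (tendsto_add_atTop_nat N))
      (fun i => hbh (i + N)) fun i => hh (i + N)
  have hf : f ∈ boundSet fun m => ⨅ i, h (i + N) m := fun m => le_ciInf fun i =>
    (hB m).trans ((hN _ (Nat.le_add_left N i)).trans (hbh _ m))
  refine ⟨N, mem_of_superset ((isOpen_boundSet hinf).mem_nhds hf) fun f' hf' n hn => hhW n ?_⟩
  intro m
  obtain ⟨i, rfl⟩ := Nat.exists_eq_add_of_le' hn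
  exact (hf' m).trans (ciInf_le (OrderBot.bddBelow _) i)

/-! ### The generic function and its range -/

theorem hasGraph_genericFun : HasGraph genericFun.{u} (fun i : ℕ × ℕ => i.1)
    (fun i => natN i.2) fun i => valueOpen i.1 i.2 := fun z => by
  simp only [genericFun, memV, eqV_check_psPair]
  exact iSup_ulift _

theorem memV_rngG (y : Model.{u}) :
    memV y rngG = ⨆ i : ℕ × ℕ, valueOpen i.1 i.2 ⊓ eqV y (natN i.2) :=
  iSup_ulift _

theorem mem_memV_genericFun {z : Model.{u}} {f : T} :
    f ∈ memV z genericFun ↔ ∃ n, f ∈ eqV z (pairN (natN n) (natN (f.1 n))) := by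
  rw [hasGraph_genericFun, Opens.mem_iSup]
  refine ⟨?_, fun ⟨n, hn⟩ => ⟨(n, f.1 n), rfl, hn⟩⟩
  rintro ⟨⟨n, x⟩, hx, hn⟩
  obtain rfl : f.1 n = x := hx
  exact ⟨n, hn⟩

theorem mem_memV_rngG {y : Model.{u}} {f : T} :
    f ∈ memV y rngG ↔ ∃ n, f ∈ eqV y (natN (f.1 n)) := by
  rw [memV_rngG, Opens.mem_iSup]
  refine ⟨?_, fun ⟨n, hn⟩ => ⟨(n, f.1 n), rfl, hn⟩⟩
  rintro ⟨⟨n, x⟩, hx, hn⟩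
  obtain rfl : f.1 n = x := hx
  exact ⟨n, hn⟩

theorem isFunOn_genericFun : isFunOn genericFun.{u} omegaN = ⊤ := by
  refine hasGraph_genericFun.isFunOn_omegaN (fun n => ?_) ?_
  · refine top_le_iff.1 fun f _ => ?_
    have hle : valueOpen n (f.1 n) ≤ ⨆ (i : ℕ × ℕ) (_ : i.1 = n), valueOpen i.1 i.2 :=
      le_iSup₂_of_le (n, f.1 n) rfl le_rfl
    exact hle rfl
  · rintro ⟨n, x⟩ ⟨_, y⟩ rfl f ⟨hx, hy⟩
    obtain rfl : x = y := Eq.trans (Eq.symm hx) hy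
    rw [eqV_self]
    trivial

theorem isFun_genericFun : isFun genericFun.{u} omegaN omegaN = ⊤ := by
  refine top_le_iff.1 (hasGraph_genericFun.le_isFun_omegaN isFunOn_genericFun.ge fun i => ?_)
  rw [memV_omegaN]
  exact le_top.trans (le_iSup_of_le i.2 (eqV_self _).ge)

theorem isRange_rngG_genericFun : isRange rngG.{u} genericFun omegaN = ⊤ := by
  simp only [isRange, memV_rngG, hasGraph_genericFun.exIn_omegaN_appV, iffV_self, iInf_top]

theorem subsetV_rngG_omegaN : subsetV rngG.{u} omegaN = ⊤ := by
  refine iInf_eq_top.2 fun y => himp_eq_top_iff.2 ?_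
  simp only [memV_rngG, memV_omegaN]
  exact iSup_le fun i => le_iSup_of_le i.2 inf_le_right

theorem countableV_rngG : countableV rngG.{u} = ⊤ :=
  top_le_iff.1 <| le_iSup_of_le genericFun <|
    le_inf isFunOn_genericFun.ge isRange_rngG_genericFun.ge

theorem memV_pointSet (z : Model.{u}) (f : T) :
    memV z (check (pointSet f)) = ⨆ n, eqV z (pairN (natN n) (natN (f.1 n))) := by
  simp only [memV_check, pointSet, PSet.Func, eqV_check_psPair]
  exact iSup_ulift _

theorem exIn_genericFilter {φ : Model.{u} → Opens T} (hφ : ExtPred φ) :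
    exIn genericFilter φ = ⨆ r, r ⊓ φ (check (openSet r)) := by
  rw [exIn_eq_iSup hφ]
  exact iSup_ulift _

theorem allIn_openSet {φ : Model.{u} → Opens T} (hφ : ExtPred φ) (r : Opens T) :
    allIn (check (openSet r)) φ = ⨅ f : {f // f ∈ r}, φ (check (pointSet f.1)) := by
  rw [allIn_check hφ]
  exact iInf_ulift _

theorem isGenericFun_genericFun : isGenericFun genericFun.{u} = ⊤ := by
  suffices h : ∀ z : Model.{u}, memV z genericFun =
      exIn genericFilter fun r => allIn r fun f => memV z f by
    simp only [isGenericFun, ← h, iffV_self, iInf_top]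
  intro z
  rw [exIn_genericFilter (by fun_prop)]
  simp only [allIn_openSet (extPred_memV_right z), memV_pointSet]
  refine le_antisymm ?_ (iSup_le fun r => ?_)
  · rw [hasGraph_genericFun]
    refine iSup_le fun i => le_iSup_of_le (valueOpen i.1 i.2) (inf_le_inf_left _ ?_)
    exact le_iInf fun ⟨f, hf⟩ => le_iSup_of_le i.1 (by rw [show f.1 i.1 = i.2 from hf])
  · rintro f ⟨hfr, hf⟩
    have hle : (⨅ f : {f // f ∈ r}, ⨆ n, eqV z (pairN (natN n) (natN (f.1.1 n)))) ≤ _ :=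
      iInf_le _ ⟨f, hfr⟩
    exact mem_memV_genericFun.2 (Opens.mem_iSup.1 (hle hf))

theorem boundedV_rngG : boundedV rngG.{u} = ⊥ := by
  rw [boundedV, exIn_omegaN (by fun_prop), iSup_eq_bot]
  refine fun B => Opens.not_nonempty_iff_eq_bot _ |>.1 fun hne => ?_
  obtain ⟨f, hf, n, hn⟩ := (dense_setOf_exists_lt B).inter_open_nonempty _ (Opens.isOpen _) hne
  have hmem : f ∈ memV (natN (f.1 n)) rngG.{u} :=
    mem_memV_rngG.2 ⟨n, by rw [eqV_self]; trivial⟩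
  have hbound : (allIn rngG fun x => leV x (natN B)) ⊓ memV (natN (f.1 n)) rngG ≤
      leV (natN (f.1 n)) (natN B : Model.{u}) := le_himp_iff.1 (iInf_le _ _)
  rw [leV_natN_of_lt hn] at hbound
  exact hbound ⟨hf, hmem⟩

theorem seqPseudoBounded_eq (a : Model.{u}) : seqPseudoBounded a = ⨅ k, ⨆ N, ⨅ n,
    leV (natN N : Model.{u}) (natN n) ⇨ ⨆ l, appV a (natN n) l ⊓ mulLt (natN k) l (natN n) := by
  rw [seqPseudoBounded, allIn_omegaN (by fun_prop)]
  refine iInf_congr fun k => ?_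
  rw [exIn_omegaN (by fun_prop)]
  exact iSup_congr fun N => allIn_omegaN (by fun_prop)

theorem mem_iSup_appV_inf_mulLt {a : Model.{u}} {f : T} (ha : f ∈ isFun a omegaN rngG)
    {B k n : ℕ} (hf : f ∈ boundSet fun _ => B) (hn : k * B < n) :
    f ∈ ⨆ l, appV a (natN n) l ⊓ mulLt (natN k) l (natN n) := by
  have htotal : isFun a omegaN rngG ≤ allIn omegaN fun x => ⨆ y, appV a x y :=
    inf_le_left.trans (inf_le_left.trans inf_le_right)
  rw [allIn_omegaN (by fun_prop)] at htotal
  obtain ⟨y, hy⟩ := Opens.mem_iSup.1 (htotal.trans (iInf_le _ n) ha)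
  have hmaps : isFun a omegaN rngG ⊓ appV a (natN n) y ≤ memV y rngG := isFun_inf_appV_le ..
  obtain ⟨i, hi⟩ := mem_memV_rngG.1 (hmaps ⟨ha, hy⟩)
  have happ : f ∈ appV a (natN n) (natN (f.1 i)) :=
    (show ExtPred fun y => appV a (natN n) y by fun_prop) y _ ⟨hi, hy⟩
  refine Opens.mem_iSup.2 ⟨natN (f.1 i), happ, ?_⟩
  have hlt : mulLt (natN k) (natN (f.1 i)) (natN n : Model.{u}) = ⊤ :=
    mulLt_natN_of_lt ((Nat.mul_le_mul_left k (hf i)).trans_lt hn)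
  rw [hlt]
  trivial

theorem pseudoBounded_rngG : pseudoBounded rngG.{u} = ⊤ := by
  refine iInf_eq_top.2 fun a => himp_eq_top_iff.2 ?_
  rw [seqPseudoBounded_eq]
  refine le_iInf fun k f hf => Opens.mem_iSup.2 ?_
  let S (n : ℕ) : Opens T := ⨆ l, appV a (natN n) l ⊓ mulLt (natN k) l (natN n)
  obtain ⟨_, ⟨p, rfl⟩, hfp, hp⟩ :=
    isTopologicalBasis_range_toSet.exists_subset_of_mem_open hf (Opens.isOpen _)
  -- outside the clopen set `p.toSet` nothing has to be shown
  have hW (n : ℕ) : IsOpen (p.toSetᶜ ∪ S (n + 1)) :=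
    p.isClosed_toSet.isOpen_compl.union (S (n + 1)).isOpen
  have hbW (n : ℕ) : (boundSet fun _ => n / (k + 1)) ⊆ p.toSetᶜ ∪ S (n + 1) := fun f' hf' =>
    or_iff_not_imp_left.2 fun hfp' => mem_iSup_appV_inf_mulLt (hp (not_not.1 hfp')) hf'
      (by have := Nat.mul_div_le n (k + 1); lia)
  obtain ⟨N, hN⟩ :=
    exists_eventually_forall_ge_mem hW (Nat.tendsto_div_const_atTop k.succ_ne_zero) hbW f
  obtain ⟨V, hV, hVopen, hfV⟩ := eventually_nhds_iff.1
    (hN.and (p.isOpen_toSet.eventually_mem hfp))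
  refine ⟨N + 1, (le_iInf fun n => le_himp_iff.2 ?_ : (⟨V, hVopen⟩ : Opens T) ≤ _) hfV⟩
  rintro f' ⟨hf', hle⟩
  obtain hn | hn := lt_or_ge n (N + 1)
  · rw [leV_natN_of_lt hn] at hle
    exact hle.elim
  · obtain ⟨m, rfl⟩ := Nat.exists_eq_add_of_le' (Nat.one_le_of_lt hn)
    exact ((hV f' hf').1 m (Nat.le_of_succ_le_succ hn)).resolve_left (not_not.2 (hV f' hf').2)

theorem bdN_eq_bot : bdN.{u} (H := Opens T) = ⊥ := by
  refine le_bot_iff.1 ((iInf_le _ rngG).trans_eq ?_)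
  rw [subsetV_rngG_omegaN, countableV_rngG, pseudoBounded_rngG, boundedV_rngG, inf_idem,
    inf_idem, top_himp]

end TopModel

theorem mainTheorem1 :
    -- `G` is the function given by the generic term; it maps `ω` to `ω` and has range `rng(G)`
    TopModel.Forced (TopModel.isGenericFun TopModel.genericFun.{u}) ∧
    TopModel.Forced (TopModel.isFun TopModel.genericFun.{u} TopModel.omegaN TopModel.omegaN) ∧
    TopModel.Forced (TopModel.isRange TopModel.rngG.{u} TopModel.genericFun TopModel.omegaN) ∧
    -- `rng(G)` is a countable and pseudo-bounded set of natural numbers, and not bounded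
    TopModel.Forced (TopModel.subsetV TopModel.rngG.{u} TopModel.omegaN) ∧
    TopModel.Forced (TopModel.countableV TopModel.rngG.{u}) ∧
    TopModel.Forced (TopModel.pseudoBounded TopModel.rngG.{u}) ∧
    TopModel.Forced (TopModel.boundedV TopModel.rngG.{u})ᶜ ∧
    -- BD-ℕ fails
    TopModel.Forced (TopModel.bdN.{u, 0})ᶜ ∧
    -- Dependent Choice, for all formulas with parameters, over the model and on each set
    (∀ (n : ℕ) (φ : TopModel.SetFormula (n + 2)) (w : Fin n → TopModel.Model.{u}),
      TopModel.Forced (TopModel.dcClass (TopModel.relOf φ w)) ∧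
      TopModel.Forced (TopModel.dcSet (TopModel.relOf φ w))) := by
  refine ⟨TopModel.isGenericFun_genericFun, TopModel.isFun_genericFun,
    TopModel.isRange_rngG_genericFun, TopModel.subsetV_rngG_omegaN, TopModel.countableV_rngG,
    TopModel.pseudoBounded_rngG, ?_, ?_, fun n φ w => ⟨?_, ?_⟩⟩
  · rw [TopModel.boundedV_rngG, compl_bot, TopModel.Forced]
  · rw [TopModel.bdN_eq_bot, compl_bot, TopModel.Forced]
  · exact TopModel.maximumPrinciple_opens_T.dcClass_eq_top (TopModel.extPred_relOf φ w)
  · exact TopModel.maximumPrinciple_opens_T.dcSet_eq_top (TopModel.extPred_relOf φ w)
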